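/- Let $F$ be a formally real field (i.e. $-1$ is not a sum of squares in $F$) that is not pythagorean (i.e. some sum of squares in $F$ is not a square). By a form over $F$ we mean a nondegenerate finite-dimensional quadratic form over $F$. For forms $\varphi,\psi$, write $\varphi\cong\psi$ if they are isometric, and write $\varphi\subseteq\psi$ (say that $\varphi$ is a subform of $\psi$) if $\psi\cong\varphi\perp\tau$ for some form $\tau$; $\varphi$ and $\psi$ are similar if $\psi\cong a\varphi$ for some $a\in F^*$. Write $m\times\varphi=\varphi\perp\dots\perp\varphi$ ($m$ summands). For $n\ge 1$, an $n$-fold Pfister form is a form isometric to $\langle 1,-a_1\rangle\otimes\dots\otimes\langle 1,-a_n\rangle$ with $a_1,\dots,a_n\in F^*$. A form is torsion if its class in the Witt ring $WF$ has finite additive order. A supreme torsion form over $F$ is an anisotropic torsion form $\varphi$ such that every anisotropic torsion form over $F$ is similar to a subform of $\varphi$. The height $h(F)\in\mathbb N\cup\{\infty\}$ is the exponent of the additive torsion subgroup $W_tF$ of $WF$, i.e. the least integer $m\ge 1$ with $m\cdot W_tF=0$, and $h(F)=\infty$ if there is no such $m$. **Theorem.** Let $n\ge 1$ be an integer and let $\pi$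 be a supreme torsion form over $F$ that is an $n$-fold Pfister form. Then $h(F)\le 2^n$. Moreover, $h(F)=2^n$ if and only if $2^{n-1}\times\langle 1\rangle\subseteq\pi$. -/

import Mathlib

namespace SupremeTorsion

universe u

open scoped TensorProduct

/-- A quadratic form over `F` (a field of characteristic not `2`): a nondegenerate quadratic form
on a finite-dimensional `F`-vector space. The zero-dimensional form is allowed. -/
structure QForm (F : Type u) [Field F] where
  /-- the underlying vector space -/
  V : Type u
  [addCommGroup : AddCommGroup V]
  [module : Module F V]
  [finiteDimensional : FiniteDimensional F V]
  /-- the quadratic form -/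
  form : QuadraticForm F V
  nondegenerate : form.Nondegenerate

attribute [instance] QForm.addCommGroup QForm.module QForm.finiteDimensional

/-- Over a field of characteristic not `2`, nondegeneracy means that the polar form has trivial
kernel. -/
theorem nondegenerate_iff {F : Type u} [Field F] [NeZero (2 : F)] {V : Type u} [AddCommGroup V]
    [Module F V] (Q : QuadraticForm F V) :
    Q.Nondegenerate ↔ ∀ x, (∀ y, QuadraticMap.polar Q x y = 0) → x = 0 := by
  let : Invertible (2 : F) := invertibleOfNonzero (NeZero.ne 2)
  rw [QuadraticMap.nondegenerate_iff_radical_eq_bot, QuadraticMap.radical_eq_ker_polarBilin,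
    Submodule.eq_bot_iff]
  simp [LinearMap.ext_iff]

namespace QForm

variable {F : Type u} [Field F]

/-- Isometry of forms. -/
def Isometric (φ ψ : QForm F) : Prop := φ.form.Equivalent ψ.form

/-- A form is anisotropic if it represents zero only at the zero vector. -/
def IsAnisotropic (φ : QForm F) : Prop := φ.form.Anisotropic

variable [NeZero (2 : F)]

/-- The zero-dimensional form. -/
abbrev zero (F : Type u) [Field F] [NeZero (2 : F)] : QForm F where
  V := PUnit.{u + 1}
  form := 0
  nondegenerate := (nondegenerate_iff _).2 fun _ _ => Subsingleton.elim _ _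

/-- The orthogonal sum `φ ⊥ ψ`. -/
abbrev perp (φ ψ : QForm F) : QForm F where
  V := φ.V × ψ.V
  form := φ.form.prod ψ.form
  nondegenerate := by
    have h₁ := (nondegenerate_iff _).1 φ.nondegenerate
    have h₂ := (nondegenerate_iff _).1 ψ.nondegenerate
    refine (nondegenerate_iff _).2 fun x hx => Prod.ext (h₁ _ fun y => ?_) (h₂ _ fun y => ?_)
    · simpa [QuadraticMap.polar] using hx (y, 0)
    · simpa [QuadraticMap.polar] using hx (0, y)

/-- The scaled form `a φ`. -/
abbrev scale (a : Fˣ) (φ : QForm F) : QForm F where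
  V := φ.V
  form := (a : F) • φ.form
  nondegenerate := by
    have h := (nondegenerate_iff _).1 φ.nondegenerate
    refine (nondegenerate_iff _).2 fun x hx => h x fun y => ?_
    have := hx y
    simpa [QuadraticMap.polar, ← mul_sub] using this

/-- The diagonal form `⟨a₁, …, aₙ⟩`. -/
abbrev diag {n : ℕ} (a : Fin n → Fˣ) : QForm F where
  V := Fin n → F
  form := QuadraticMap.weightedSumSquares F (fun i => (a i : F))
  nondegenerate := by
    let : Invertible (2 : F) := invertibleOfNonzero (NeZero.ne 2)
    rw [QuadraticMap.nondegenerate_iff_radical_eq_bot, QuadraticForm.radical_weightedSumSquares,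
      Submodule.eq_bot_iff]
    intro x hx
    rw [Pi.mem_spanSubset_iff] at hx
    funext i
    exact hx i (by simp)

/-- The tensor product `φ ⊗ ψ`. -/
noncomputable abbrev tensor (φ ψ : QForm F) : QForm F :=
  letI : Invertible (2 : F) := invertibleOfNonzero (NeZero.ne 2)
  { V := φ.V ⊗[F] ψ.V
    form := QuadraticForm.tmul φ.form ψ.form
    nondegenerate := by
      obtain ⟨v, hv⟩ := LinearMap.BilinForm.exists_orthogonal_basis
        (B := QuadraticMap.associated φ.form) ⟨QuadraticMap.associated_isSymm F φ.form⟩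
      obtain ⟨w, hw⟩ := LinearMap.BilinForm.exists_orthogonal_basis
        (B := QuadraticMap.associated ψ.form) ⟨QuadraticMap.associated_isSymm F ψ.form⟩
      have hv' := hv.not_isOrtho_basis_self_of_separatingLeft
        (QuadraticMap.nondegenerate_associated_iff.2 φ.nondegenerate).1
      have hw' := hw.not_isOrtho_basis_self_of_separatingLeft
        (QuadraticMap.nondegenerate_associated_iff.2 ψ.nondegenerate).1
      rw [LinearMap.isOrthoᵢ_def] at hv hw
      rw [← QuadraticMap.nondegenerate_associated_iff, QuadraticForm.associated_tmul]
      refine LinearMap.IsOrthoᵢ.nondegenerate_of_not_isOrtho_basis_self (v.tensorProduct w) ?_ ?_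
      · rw [LinearMap.isOrthoᵢ_def]
        rintro ⟨i, j⟩ ⟨i', j'⟩ hij
        rw [Module.Basis.tensorProduct_apply, Module.Basis.tensorProduct_apply,
          LinearMap.BilinForm.tensorDistrib_tmul]
        by_cases hi : i = i'
        · have hj : j ≠ j' := fun hj => hij (by rw [hi, hj])
          rw [hw j j' hj, zero_smul]
        · rw [hv i i' hi, smul_zero]
      · rintro ⟨i, j⟩
        rw [Module.Basis.tensorProduct_apply, LinearMap.BilinForm.tensorDistrib_tmul]
        exact smul_ne_zero (hw' j) (hv' i) }

/-- The `m`-fold orthogonal sum `m × φ = φ ⊥ … ⊥ φ`. -/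
def copies : ℕ → QForm F → QForm F
  | 0, _ => zero F
  | m + 1, φ => perp (copies m φ) φ

/-- The Pfister form `⟨1, -a₁⟩ ⊗ … ⊗ ⟨1, -aₙ⟩`; the empty product is `⟨1⟩`. -/
noncomputable def pfister : {n : ℕ} → (Fin n → Fˣ) → QForm F
  | 0, _ => diag ![1]
  | _ + 1, a => tensor (diag ![1, -a 0]) (pfister (Fin.tail a))

/-- `φ` is (isometric to) an `n`-fold Pfister form. -/
def IsPfister (n : ℕ) (φ : QForm F) : Prop := ∃ a : Fin n → Fˣ, Isometric φ (pfister a)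

/-- `φ` is a subform of `ψ`: `ψ ≅ φ ⊥ τ` for some form `τ`. -/
def IsSubform (φ ψ : QForm F) : Prop := ∃ τ : QForm F, Isometric (perp φ τ) ψ

/-- `φ` and `ψ` are similar: `ψ ≅ a φ` for some nonzero scalar `a`. -/
def Similar (φ ψ : QForm F) : Prop := ∃ a : Fˣ, Isometric (scale a φ) ψ

/-- The hyperbolic plane `⟨1, -1⟩`. -/
def hyperbolicPlane (F : Type u) [Field F] [NeZero (2 : F)] : QForm F := diag ![1, -1]

instance isometrySetoid (F : Type u) [Field F] : Setoid (QForm F) where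
  r := Isometric
  iseqv :=
    { refl := fun φ => QuadraticMap.Equivalent.refl φ.form
      symm := fun h => QuadraticMap.Equivalent.symm h
      trans := fun h h' => QuadraticMap.Equivalent.trans h h' }

end QForm

open QForm

/-- Isometry classes of forms over `F`. -/
def IsometryClass (F : Type u) [Field F] : Type (u + 1) := Quotient (isometrySetoid F)

/-- The isometry class of a form. -/
def isometryClass {F : Type u} [Field F] (φ : QForm F) : IsometryClass F :=
  Quotient.mk (isometrySetoid F) φ

/-- Addition of isometry classes: the orthogonal sum. -/
instance (F : Type u) [Field F] [NeZero (2 : F)] : Add (IsometryClass F) where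
  add := Quotient.map₂ perp fun _ _ h _ _ h' => QuadraticMap.Equivalent.prod h h'

instance (F : Type u) [Field F] [NeZero (2 : F)] : Zero (IsometryClass F) where
  zero := isometryClass (zero F)

instance (F : Type u) [Field F] [NeZero (2 : F)] : AddCommMonoid (IsometryClass F) where
  nsmul := nsmulRec
  add_assoc := by
    rintro ⟨φ⟩ ⟨ψ⟩ ⟨χ⟩
    refine Quotient.sound ⟨⟨LinearEquiv.prodAssoc F φ.V ψ.V χ.V, ?_⟩⟩
    rintro ⟨⟨x, y⟩, z⟩
    exact (add_assoc (φ.form x) (ψ.form y) (χ.form z)).symm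
  zero_add := by
    rintro ⟨φ⟩
    refine Quotient.sound ⟨⟨(LinearEquiv.uniqueProd : (PUnit.{u + 1} × φ.V) ≃ₗ[F] φ.V), ?_⟩⟩
    rintro ⟨x, y⟩
    exact (zero_add (φ.form y)).symm
  add_zero := by
    rintro ⟨φ⟩
    refine Quotient.sound ⟨⟨(LinearEquiv.prodUnique : (φ.V × PUnit.{u + 1}) ≃ₗ[F] φ.V), ?_⟩⟩
    rintro ⟨x, y⟩
    exact (add_zero (φ.form x)).symm
  add_comm := by
    rintro ⟨φ⟩ ⟨ψ⟩
    exact Quotient.sound ⟨QuadraticMap.IsometryEquiv.prodComm φ.form ψ.form⟩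

/-- The class of a form in the Witt-Grothendieck group, i.e. in the Grothendieck group of the
monoid of isometry classes. -/
def grothendieckClass {F : Type u} [Field F] [NeZero (2 : F)] (φ : QForm F) :
    Algebra.GrothendieckAddGroup (IsometryClass F) :=
  Algebra.GrothendieckAddGroup.of (isometryClass φ)

/-- The additive group of the Witt ring `WF`: the Witt-Grothendieck group modulo the subgroup
generated by the hyperbolic plane. -/
abbrev WittGroup (F : Type u) [Field F] [NeZero (2 : F)] : Type (u + 1) :=
  Algebra.GrothendieckAddGroup (IsometryClass F) ⧸
    AddSubgroup.zmultiples (grothendieckClass (hyperbolicPlane F))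

/-- The Witt class of a form. -/
def wittClass {F : Type u} [Field F] [NeZero (2 : F)] (φ : QForm F) : WittGroup F :=
  QuotientAddGroup.mk' (AddSubgroup.zmultiples (grothendieckClass (hyperbolicPlane F)))
    (grothendieckClass φ)

/-- A form is torsion if its Witt class has finite additive order. -/
def IsTorsionForm {F : Type u} [Field F] [NeZero (2 : F)] (φ : QForm F) : Prop :=
  wittClass φ ∈ AddCommGroup.torsion (WittGroup F)

/-- A supreme torsion form: an anisotropic torsion form such that every anisotropic torsion form
over `F` is similar to a subform of it. -/
def IsSupremeTorsionForm {F : Type u} [Field F] [NeZero (2 : F)] (φ : QForm F) : Prop :=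
  IsAnisotropic φ ∧ IsTorsionForm φ ∧
    ∀ ψ : QForm F, IsAnisotropic ψ → IsTorsionForm ψ → ∃ χ : QForm F, IsSubform χ φ ∧ Similar ψ χ

/-- The height `h(F)`: the exponent of the torsion subgroup of the Witt ring, or `∞` if no positive
integer annihilates it (`AddMonoid.exponent` is `0` in that case). -/
noncomputable def height (F : Type u) [Field F] [NeZero (2 : F)] : ℕ∞ :=
  if AddMonoid.exponent (AddCommGroup.torsion (WittGroup F)) = 0 then ⊤
  else (AddMonoid.exponent (AddCommGroup.torsion (WittGroup F)) : ℕ∞)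

end SupremeTorsion

/-!
Throughout, `s` is a nonzero sum of squares. The proof works in the monoid of isometry classes,
which is cancellative by Witt's theorem (a reflection, up to sign, moves any vector to any other of
the same nonzero value), so that a form is determined by its Witt class together with its dimension.

*Torsion is controlled by the forms `⟨1, -s⟩`.* If a positive multiple of `⟨a₁, …, a_d⟩` is
hyperbolic, it is isotropic, and an isotropic vector gives a relation `∑ aᵢ sᵢ = 0` in which the
`sᵢ` are sums of squares, not all zero because the field is formally real. Replacing `aᵢ` by `aᵢ sᵢ`
where `sᵢ ≠ 0` changes the Witt class by the classes of `aᵢ⟨1, -sᵢ⟩` and makes the form isotropic,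
so a hyperbolic plane splits off. By induction on the dimension, an integer `K > 0` annihilates all
torsion as soon as it annihilates every `⟨1, -s⟩` (`smul_witt_eq_zero_of_torsion`).

*The height is at most `2 ^ n`.* The forms `2 ^ k × ⟨1⟩` and `2 ^ k × ⟨1, -s⟩` are Pfister forms:
they are round, and hyperbolic if isotropic (`PfisterLike`). Hence `⟨1, -s⟩` is torsion. The torsion
form `2 ^ n × ⟨1, -s⟩` has dimension `2 ^ (n + 1) > dim π`, so it is not similar to a subform of the
supreme form `π`. It is therefore isotropic, hence hyperbolic. So the exponent of the torsion
subgroup divides `2 ^ n`.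

*Equality.* If the height is `2 ^ n`, then some `2 ^ (n - 1) × ⟨1, -s⟩` is not hyperbolic; being
anisotropic of the dimension of `π`, it is similar to `π`, and by roundness isometric to `π`, since
`π` represents `1`. Hence `π` contains `2 ^ (n - 1) × ⟨1⟩`. Conversely let
`π ≅ 2 ^ (n - 1) × ⟨1⟩ ⊥ τ`, and suppose that the height is smaller than `2 ^ n`, i.e. that
`2 ^ (n - 1)` annihilates all torsion. As `π` is torsion, `N × τ ≅ -(N 2 ^ (n - 1)) × ⟨1⟩` for some
`N > 0`, so a value of `τ` is `-s` for a sum of squares `s`. By assumption `s` is already a value of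
`2 ^ (n - 1) × ⟨1⟩`, so `π` is isotropic, a contradiction.
-/

namespace SupremeTorsion

universe u

open QForm

/-! ### Witt cancellation and splitting of orthogonal summands -/

section Isometries

variable {F : Type u} [Field F] {V : Type u} [AddCommGroup V] [Module F V]

/-- The isometry is a reflection in `w`. -/
theorem exists_isometryEquiv_reflection (Q : QuadraticForm F V) (w : V) (hw : Q w ≠ 0) :
    ∃ g : Q.IsometryEquiv Q, ∀ x, g x = x - (QuadraticMap.polar Q w x / Q w) • w := by
  have h2 : ((Q w)⁻¹ • Q.polarBilin w) w = 2 := by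
    simp [QuadraticMap.polar_self]
    field_simp
  refine ⟨⟨Module.reflection h2, fun x => ?_⟩, fun x => ?_⟩
  · change Q (Module.reflection h2 x) = Q x
    rw [Module.reflection_apply, sub_eq_add_neg, ← neg_smul, QuadraticMap.map_add Q,
      QuadraticMap.polar_smul_right, QuadraticMap.map_smul, QuadraticMap.polar_comm]
    simp
    field_simp
    ring
  · change Module.reflection h2 x = _
    rw [Module.reflection_apply]
    simp [div_eq_inv_mul]

theorem exists_isometryEquiv_map_eq [NeZero (2 : F)] (Q : QuadraticForm F V) {e f : V}
    (h : Q f = Q e) (he : Q e ≠ 0) : ∃ g : Q.IsometryEquiv Q, g f = e := by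
  have h2 : (2 : F) ≠ 0 := NeZero.ne 2
  have hsub : Q (f - e) = 2 * Q e - QuadraticMap.polar Q f e := by
    rw [sub_eq_add_neg, QuadraticMap.map_add Q, QuadraticMap.polar_neg_right,
      QuadraticMap.map_neg, h]
    ring
  have hadd : Q (f + e) = 2 * Q e + QuadraticMap.polar Q f e := by
    rw [QuadraticMap.map_add Q, h]
    ring
  by_cases h0 : Q (f - e) = 0
  · -- Here `Q (f + e) = 4 * Q e`, and the reflection in `f + e` maps `f` to `-e`.
    have h1 : Q (f + e) ≠ 0 := by
      have : Q (f + e) = 2 * 2 * Q e := by linear_combination hadd + hsub - h0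
      rw [this]
      exact mul_ne_zero (mul_ne_zero h2 h2) he
    obtain ⟨g, hg⟩ := exists_isometryEquiv_reflection Q (f + e) h1
    refine ⟨g.trans ⟨LinearEquiv.neg F, fun x => ?_⟩, ?_⟩
    · exact Q.map_neg x
    · change -(g f) = e
      have : QuadraticMap.polar Q (f + e) f / Q (f + e) = 1 := by
        rw [div_eq_one_iff_eq h1, QuadraticMap.polar_add_left, QuadraticMap.polar_self, hadd, h,
          QuadraticMap.polar_comm Q e f]
        simp
      rw [hg, this, one_smul]
      abel
  · obtain ⟨g, hg⟩ := exists_isometryEquiv_reflection Q (f - e) h0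
    refine ⟨g, ?_⟩
    have : QuadraticMap.polar Q (f - e) f / Q (f - e) = 1 := by
      rw [div_eq_one_iff_eq h0, QuadraticMap.polar_sub_left, QuadraticMap.polar_self, hsub, h,
        QuadraticMap.polar_comm Q e f]
      simp
    rw [hg, this, one_smul]
    abel

end Isometries

section

variable {F : Type u} [Field F] [NeZero (2 : F)]

theorem diag_one_apply (u : Fˣ) (v : Fin 1 → F) : (diag ![u]).form v = u * (v 0 * v 0) := by
  simp [QuadraticMap.weightedSumSquares_apply]

/-- **Witt cancellation** for a one-dimensional summand. An isometry
`⟨u⟩ ⊥ φ ≅ ⟨u⟩ ⊥ ψ` can be corrected by an isometry of the target so as to fix the basis vector of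
`⟨u⟩`; it then restricts to the orthogonal complements. -/
theorem isometric_of_perp_diag_one {u : Fˣ} {φ ψ : QForm F}
    (h : Isometric (perp (diag ![u]) φ) (perp (diag ![u]) ψ)) : Isometric φ ψ := by
  obtain ⟨g⟩ := h
  have h2 : (2 : F) ≠ 0 := NeZero.ne 2
  have hu : (u : F) ≠ 0 := u.ne_zero
  let e : (Fin 1 → F) × φ.V := (fun _ => 1, 0)
  let e' : (Fin 1 → F) × ψ.V := (fun _ => 1, 0)
  have he : (perp (diag ![u]) φ).form e = u := by
    simp [e, QuadraticMap.weightedSumSquares_apply]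
  have he' : (perp (diag ![u]) ψ).form e' = u := by
    simp [e', QuadraticMap.weightedSumSquares_apply]
  obtain ⟨r, hr⟩ := exists_isometryEquiv_map_eq (perp (diag ![u]) ψ).form
    (e := e') (f := g e) (by rw [g.map_app, he, he']) (by rw [he']; exact hu)
  let k := g.trans r
  have hk : k e = e' := hr
  have hk' : k.symm e' = e := by rw [← hk, k.symm_apply_apply]
  -- An isometry fixing the basis vector of `⟨u⟩` preserves its orthogonal complement.
  have key : ∀ (α β : QForm F) (m : (perp (diag ![u]) α).form.IsometryEquiv
      (perp (diag ![u]) β).form), m ((fun _ => 1, 0) : (Fin 1 → F) × α.V) = (fun _ => 1, 0) →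
      ∀ x : α.V, (m ((0, x) : (Fin 1 → F) × α.V)).1 = 0 := by
    intro α β m hm x
    have h1 := m.map_app ((fun _ => 1, 0) + (0, x) : (Fin 1 → F) × α.V)
    have h0 := m.map_app ((0, x) : (Fin 1 → F) × α.V)
    rw [map_add, hm] at h1
    generalize m ((0, x) : (Fin 1 → F) × α.V) = y at h1 h0 ⊢
    obtain ⟨y₁, y₂⟩ := y
    simp [QuadraticMap.weightedSumSquares_apply] at h1 h0
    have : (u : F) * (2 * y₁ 0) = 0 := by linear_combination h1 - h0
    funext i
    rw [Subsingleton.elim i 0]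
    exact (mul_eq_zero.1 ((mul_eq_zero.1 this).resolve_left hu)).resolve_left h2
  have hin := key φ ψ k hk
  have hout := key ψ φ k.symm hk'
  have hin' : ∀ x : φ.V, k ((0, x) : (Fin 1 → F) × φ.V) = (0, (k ((0, x) : (Fin 1 → F) × φ.V)).2) :=
    fun x => Prod.ext (hin x) rfl
  have hout' : ∀ x : ψ.V, k.symm ((0, x) : (Fin 1 → F) × ψ.V) =
      (0, (k.symm ((0, x) : (Fin 1 → F) × ψ.V)).2) := fun x => Prod.ext (hout x) rfl
  let l : φ.V ≃ₗ[F] ψ.V :=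
    { toFun := fun x => (k ((0, x) : (Fin 1 → F) × φ.V)).2
      invFun := fun x => (k.symm ((0, x) : (Fin 1 → F) × ψ.V)).2
      map_add' := fun x y => by
        rw [← Prod.snd_add, ← map_add]
        simp
      map_smul' := fun a x => by
        rw [RingHom.id_apply, ← Prod.smul_snd, ← map_smul]
        simp
      left_inv := fun x => by
        change (k.symm ((0, (k ((0, x) : (Fin 1 → F) × φ.V)).2) : (Fin 1 → F) × ψ.V)).2 = x
        rw [← hin', k.symm_apply_apply]
      right_inv := fun x => by
        change (k ((0, (k.symm ((0, x) : (Fin 1 → F) × ψ.V)).2) : (Fin 1 → F) × φ.V)).2 = x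
        rw [← hout', k.apply_symm_apply] }
  refine ⟨⟨l, fun x => ?_⟩⟩
  change ψ.form (k ((0, x) : (Fin 1 → F) × φ.V)).2 = φ.form x
  have h0 := k.map_app ((0, x) : (Fin 1 → F) × φ.V)
  rw [hin'] at h0
  exact add_left_cancel (a := (diag ![u]).form 0) h0

/-- A vector `v` with `φ v = u ≠ 0` splits off the summand `⟨u⟩`, and the values of `φ` on the
orthogonal complement of `v` are values of the remaining summand. -/
theorem exists_isometric_perp_of_apply_eq (φ : QForm F) {v : φ.V} {u : Fˣ} (hv : φ.form v = u) :
    ∃ τ : QForm F, Isometric (perp (diag ![u]) τ) φ ∧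
      ∀ r, QuadraticMap.polar φ.form v r = 0 → ∃ t, τ.form t = φ.form r := by
  have h2 : (2 : F) ≠ 0 := NeZero.ne 2
  have hu : (u : F) ≠ 0 := u.ne_zero
  let W : Submodule F φ.V := LinearMap.ker (φ.form.polarBilin v)
  have hW : ∀ x, x ∈ W ↔ QuadraticMap.polar φ.form v x = 0 := fun x => LinearMap.mem_ker
  let c : φ.V →ₗ[F] F := (2 * (u : F))⁻¹ • φ.form.polarBilin v
  have hvv : QuadraticMap.polar φ.form v v = 2 * u := by
    rw [QuadraticMap.polar_self, hv, two_smul, two_mul]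
  have hc : ∀ x, c x = (2 * (u : F))⁻¹ * QuadraticMap.polar φ.form v x := fun x => rfl
  have hmem : ∀ x, x - c x • v ∈ W := by
    intro x
    rw [hW, QuadraticMap.polar_sub_right, QuadraticMap.polar_smul_right, hvv, hc, smul_eq_mul]
    field_simp
    ring
  let τ : QForm F :=
    { V := W
      form := φ.form.comp W.subtype
      nondegenerate := by
        refine (nondegenerate_iff _).2 fun x hx => Subtype.ext ?_
        refine (nondegenerate_iff _).1 φ.nondegenerate _ fun y => ?_
        have h1 : QuadraticMap.polar φ.form x (y - c y • v) = 0 := hx ⟨_, hmem y⟩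
        have h3 : QuadraticMap.polar φ.form x v = 0 := by
          rw [QuadraticMap.polar_comm]
          exact (hW _).1 x.2
        rw [QuadraticMap.polar_sub_right, QuadraticMap.polar_smul_right, h3] at h1
        simpa using h1 }
  let l : ((Fin 1 → F) × W) ≃ₗ[F] φ.V :=
    { toFun := fun x => x.1 0 • v + x.2
      invFun := fun x => (fun _ => c x, ⟨x - c x • v, hmem x⟩)
      map_add' := fun x y => by
        simp only [Prod.fst_add, Prod.snd_add, Pi.add_apply, Submodule.coe_add]
        module
      map_smul' := fun a x => by
        simp only [Prod.smul_fst, Prod.smul_snd, Pi.smul_apply, Submodule.coe_smul, smul_eq_mul,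
          RingHom.id_apply]
        module
      left_inv := fun ⟨t, w, hw⟩ => by
        have hcw : c w = 0 := by rw [hc, (hW w).1 hw, mul_zero]
        have hcv : c v = 1 := by
          rw [hc, hvv]
          exact inv_mul_cancel₀ (mul_ne_zero h2 hu)
        refine Prod.ext (funext fun i => ?_) (Subtype.ext ?_)
        · rw [Subsingleton.elim i 0]
          simp [hcw, hcv]
        · simp [hcw, hcv]
      right_inv := fun x => by simp }
  refine ⟨τ, ⟨⟨l, ?_⟩⟩, fun r hr => ⟨⟨r, (hW r).2 hr⟩, rfl⟩⟩
  rintro ⟨t, w, hw⟩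
  change φ.form (t 0 • v + w) = (diag ![u]).form t + φ.form w
  rw [QuadraticMap.map_add φ.form, QuadraticMap.polar_smul_left, (hW w).1 hw,
    QuadraticMap.map_smul, hv, diag_one_apply]
  simp
  ring

end

/-! ### The cancellative monoid of isometry classes -/

section

variable {F : Type u} [Field F]

theorem isometryClass_eq {φ ψ : QForm F} :
    isometryClass φ = isometryClass ψ ↔ Isometric φ ψ := Quotient.eq

theorem exists_isometryClass_eq (x : IsometryClass F) : ∃ φ, isometryClass φ = x :=
  Quotient.exists_rep x

variable [NeZero (2 : F)]

/-- The isometry class of the one-dimensional form `⟨u⟩`. -/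
def unary (u : Fˣ) : IsometryClass F := isometryClass (diag ![u])

/-- The isometry class of the hyperbolic plane. -/
def hyp (F : Type u) [Field F] [NeZero (2 : F)] : IsometryClass F :=
  isometryClass (hyperbolicPlane F)

theorem isometryClass_perp (φ ψ : QForm F) :
    isometryClass (perp φ ψ) = isometryClass φ + isometryClass ψ := rfl

/-- The dimension of an isometry class. -/
noncomputable def dim : IsometryClass F →+ ℕ where
  toFun := Quotient.lift (fun φ => Module.finrank F φ.V)
    fun _ _ h => h.elim fun g => g.toLinearEquiv.finrank_eq
  map_zero' := Module.finrank_zero_of_subsingleton (M := PUnit.{u + 1})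
  map_add' := by
    rintro ⟨φ⟩ ⟨ψ⟩
    exact Module.finrank_prod (M := φ.V) (M' := ψ.V)

theorem dim_isometryClass (φ : QForm F) : dim (isometryClass φ) = Module.finrank F φ.V := rfl

@[simp] theorem dim_unary (u : Fˣ) : dim (unary u) = 1 := by
  simp [unary, dim_isometryClass]

@[simp] theorem dim_hyp : dim (hyp F) = 2 := by
  simp [hyp, hyperbolicPlane, dim_isometryClass]

theorem eq_zero_of_dim_eq_zero {x : IsometryClass F} (h : dim x = 0) : x = 0 := by
  obtain ⟨φ, rfl⟩ := exists_isometryClass_eq x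
  have : Subsingleton φ.V := Module.finrank_zero_iff.1 h
  refine (isometryClass_eq (ψ := zero F)).2
    ⟨⟨LinearEquiv.ofSubsingleton φ.V PUnit.{u + 1}, fun v => ?_⟩⟩
  rw [Subsingleton.elim v 0, QuadraticMap.map_zero]
  exact φ.form.map_zero.symm

/-- The class `x` represents `u`: it has `⟨u⟩` as an orthogonal summand. -/
def Rep (x : IsometryClass F) (u : Fˣ) : Prop := ∃ y, x = unary u + y

/-- The class `x` is isotropic: it has the hyperbolic plane as an orthogonal summand. -/
def Isotropic (x : IsometryClass F) : Prop := ∃ y, x = hyp F + y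

/-- The refinement on vectors orthogonal to `v` allows a second summand to be split off. -/
theorem exists_eq_unary_add {φ : QForm F} {v : φ.V} {u : Fˣ} (hv : φ.form v = u) :
    ∃ y, isometryClass φ = unary u + y ∧
      ∀ r (w : Fˣ), QuadraticMap.polar φ.form v r = 0 → φ.form r = w → Rep y w := by
  obtain ⟨τ, hτ, h⟩ := exists_isometric_perp_of_apply_eq φ hv
  refine ⟨isometryClass τ, (isometryClass_eq.2 hτ).symm, fun r w hr hw => ?_⟩
  obtain ⟨t, ht⟩ := h r hr
  obtain ⟨τ', hτ', -⟩ := exists_isometric_perp_of_apply_eq τ (ht.trans hw)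
  exact ⟨isometryClass τ', (isometryClass_eq.2 hτ').symm⟩

theorem rep_isometryClass {φ : QForm F} {u : Fˣ} :
    Rep (isometryClass φ) u ↔ ∃ v, φ.form v = u := by
  constructor
  · rintro ⟨y, hy⟩
    obtain ⟨ψ, rfl⟩ := exists_isometryClass_eq y
    obtain ⟨g⟩ := isometryClass_eq.1 hy.symm
    refine ⟨g (fun _ => 1, 0), ?_⟩
    rw [g.map_app]
    simp [QuadraticMap.weightedSumSquares_apply]
  · rintro ⟨v, hv⟩
    obtain ⟨y, hy, -⟩ := exists_eq_unary_add hv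
    exact ⟨y, hy⟩

theorem Rep.add_right {x : IsometryClass F} {u : Fˣ} (h : Rep x u) (y : IsometryClass F) :
    Rep (x + y) u := by
  obtain ⟨z, rfl⟩ := h
  exact ⟨z + y, add_assoc _ _ _⟩

theorem Rep.add_left {x : IsometryClass F} {u : Fˣ} (h : Rep x u) (y : IsometryClass F) :
    Rep (y + x) u := add_comm x y ▸ h.add_right y

theorem exists_rep_of_dim_pos {x : IsometryClass F} (h : 0 < dim x) : ∃ u, Rep x u := by
  obtain ⟨φ, rfl⟩ := exists_isometryClass_eq x
  by_contra! H
  have h0 : ∀ v, φ.form v = 0 := fun v => by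
    by_contra hv
    exact H (Units.mk0 _ hv) (rep_isometryClass.2 ⟨v, rfl⟩)
  have : Subsingleton φ.V := ⟨fun v w => by
    rw [← sub_eq_zero]
    refine (nondegenerate_iff _).1 φ.nondegenerate _ fun y => ?_
    simp [QuadraticMap.polar, h0]⟩
  rw [dim_isometryClass, Module.finrank_zero_of_subsingleton] at h
  exact lt_irrefl _ h

/-- Diagonalization, as an induction principle for isometry classes. -/
theorem IsometryClass.induction {p : IsometryClass F → Prop} (zero : p 0)
    (add : ∀ u x, p x → p (unary u + x)) (x : IsometryClass F) : p x := by
  induction h : dim x generalizing x with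
  | zero => exact eq_zero_of_dim_eq_zero h ▸ zero
  | succ k ih =>
    obtain ⟨u, y, rfl⟩ := exists_rep_of_dim_pos (x := x) (by omega)
    rw [map_add, dim_unary] at h
    exact add u y (ih y (by omega))

/-- **Witt cancellation.** -/
instance : IsCancelAdd (IsometryClass F) := by
  have h : ∀ x y z : IsometryClass F, x + y = x + z → y = z := by
    intro x
    induction x using IsometryClass.induction with
    | zero => simp
    | add u x ih =>
      intro y z hyz
      rw [add_assoc, add_assoc] at hyz
      refine ih y z ?_
      obtain ⟨φ, hφ⟩ := exists_isometryClass_eq (x + y)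
      obtain ⟨ψ, hψ⟩ := exists_isometryClass_eq (x + z)
      rw [← hφ, ← hψ] at hyz ⊢
      exact isometryClass_eq.2 (isometric_of_perp_diag_one (isometryClass_eq.1 hyz))
  have : IsLeftCancelAdd (IsometryClass F) := ⟨fun x y z => h x y z⟩
  exact AddCommMagma.IsLeftCancelAdd.toIsCancelAdd _

theorem hyperbolicPlane_apply (v : Fin 2 → F) :
    (hyperbolicPlane F).form v = v 0 * v 0 - v 1 * v 1 := by
  change QuadraticMap.weightedSumSquares F (fun i => ((![1, -1] i : Fˣ) : F)) v = _
  simp [QuadraticMap.weightedSumSquares_apply, Fin.sum_univ_two, sub_eq_add_neg]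

theorem hyp_eq_unary_one : hyp F = unary 1 + unary (-1) := by
  obtain ⟨y, hy, h⟩ := exists_eq_unary_add (φ := hyperbolicPlane F) (v := ![1, 0]) (u := 1)
    (by rw [hyperbolicPlane_apply]; simp)
  obtain ⟨z, rfl⟩ := h ![0, 1] (-1)
    (by
      have key : ∀ v : Fin 2 → F, v = ![1, 1] → (hyperbolicPlane F).form v -
          (hyperbolicPlane F).form ![1, 0] - (hyperbolicPlane F).form ![0, 1] = 0 := by
        rintro v rfl
        rw [hyperbolicPlane_apply, hyperbolicPlane_apply, hyperbolicPlane_apply]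
        simp
      have h01 : (![1, 0] : Fin 2 → F) + ![0, 1] = ![1, 1] := by simp
      exact key _ h01)
    (by rw [hyperbolicPlane_apply]; simp)
  have hd := congrArg dim hy
  change dim (hyp F) = _ at hd
  simp only [dim_hyp, map_add, dim_unary] at hd
  rw [eq_zero_of_dim_eq_zero (x := z) (by omega), add_zero] at hy
  exact hy

/-- If `v` is an isotropic vector and `w` is chosen with `φ w = 0` and polar value `1` against `v`,
then `v + w` and `v - w` are orthogonal and have values `1` and `-1`. -/
theorem isotropic_isometryClass {φ : QForm F} :
    Isotropic (isometryClass φ) ↔ ∃ v, v ≠ 0 ∧ φ.form v = 0 := by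
  constructor
  · rintro ⟨y, hy⟩
    obtain ⟨ψ, rfl⟩ := exists_isometryClass_eq y
    obtain ⟨g⟩ := (isometryClass_eq (φ := perp (hyperbolicPlane F) ψ)).1 hy.symm
    refine ⟨g (![1, 1], 0), fun h => ?_, ?_⟩
    · rw [← map_zero g] at h
      have := congrFun (congrArg Prod.fst (g.injective h)) 0
      exact one_ne_zero (α := F) this
    · rw [g.map_app]
      change (hyperbolicPlane F).form ![1, 1] + ψ.form 0 = 0
      rw [hyperbolicPlane_apply]
      simp
  · rintro ⟨v, hv, hv0⟩
    obtain ⟨w, hw⟩ : ∃ w, QuadraticMap.polar φ.form v w ≠ 0 := by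
      by_contra! H
      exact hv ((nondegenerate_iff _).1 φ.nondegenerate v H)
    obtain ⟨w₁, hw₁⟩ : ∃ w₁, QuadraticMap.polar φ.form v w₁ = 1 :=
      ⟨(QuadraticMap.polar φ.form v w)⁻¹ • w, by
        rw [QuadraticMap.polar_smul_right, smul_eq_mul, inv_mul_cancel₀ hw]⟩
    obtain ⟨w₂, hw₂, hw₂'⟩ : ∃ w₂, QuadraticMap.polar φ.form v w₂ = 1 ∧ φ.form w₂ = 0 := by
      refine ⟨w₁ + (-φ.form w₁) • v, ?_, ?_⟩
      · rw [QuadraticMap.polar_add_right, QuadraticMap.polar_smul_right, QuadraticMap.polar_self,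
          hv0, hw₁]
        simp
      · rw [QuadraticMap.map_add φ.form, QuadraticMap.polar_smul_right, QuadraticMap.map_smul,
          QuadraticMap.polar_comm, hv0, hw₁]
        simp
    obtain ⟨y, hy, h⟩ := exists_eq_unary_add (φ := φ) (v := v + w₂) (u := 1) (by
      rw [QuadraticMap.map_add φ.form, hv0, hw₂, hw₂']
      simp)
    obtain ⟨z, rfl⟩ := h (v + -w₂) (-1)
      (by
        simp only [QuadraticMap.polar_add_right, QuadraticMap.polar_add_left,
          QuadraticMap.polar_neg_right, QuadraticMap.polar_self, hv0, hw₂, hw₂',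
          QuadraticMap.polar_comm φ.form w₂ v]
        simp)
      (by
        rw [QuadraticMap.map_add φ.form, QuadraticMap.polar_neg_right, QuadraticMap.map_neg, hv0,
          hw₂, hw₂']
        simp)
    exact ⟨z, by rw [hy, hyp_eq_unary_one, add_assoc]⟩

theorem isotropic_isometryClass_iff {φ : QForm F} :
    Isotropic (isometryClass φ) ↔ ¬ IsAnisotropic φ := by
  rw [isotropic_isometryClass, IsAnisotropic, QuadraticMap.Anisotropic]
  push Not
  simp only [and_comm]

theorem Isotropic.two_le_dim {x : IsometryClass F} (h : Isotropic x) : 2 ≤ dim x := by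
  obtain ⟨z, rfl⟩ := h
  simp

/-- `⟨u⟩ ⊥ ⟨v⟩ ≅ ⟨u + v⟩ ⊥ ⟨uv(u + v)⟩`. -/
theorem unary_add_unary {u v w : Fˣ} (h : (u : F) + v = w) :
    unary u + unary v = unary w + unary (u * v * w) := by
  obtain ⟨y, hy, hr⟩ := exists_eq_unary_add (φ := perp (diag ![u]) (diag ![v]))
    (v := (fun _ => 1, fun _ => 1)) (u := w)
    (by simpa [QuadraticMap.weightedSumSquares_apply] using h)
  obtain ⟨z, rfl⟩ := hr (fun _ => v, fun _ => -u) (u * v * w)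
    (by
      simp [QuadraticMap.weightedSumSquares_apply, QuadraticMap.polar]
      ring)
    (by
      simp [QuadraticMap.weightedSumSquares_apply, ← h]
      ring)
  rw [isometryClass_perp] at hy
  change unary u + unary v = _ at hy
  have hd := congrArg dim hy
  simp only [map_add, dim_unary] at hd
  rw [eq_zero_of_dim_eq_zero (x := z) (by omega), add_zero] at hy
  exact hy

theorem unary_add_unary_neg (u : Fˣ) : unary u + unary (-u) = hyp F := by
  obtain ⟨y, hy⟩ : Isotropic (isometryClass (perp (diag ![u]) (diag ![-u]))) := by
    refine isotropic_isometryClass.2 ⟨(fun _ => 1, fun _ => 1), fun h => ?_, ?_⟩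
    · exact one_ne_zero (α := F) (congrFun (congrArg Prod.fst h) 0)
    · simp [QuadraticMap.weightedSumSquares_apply]
  rw [isometryClass_perp] at hy
  change unary u + unary (-u) = _ at hy
  have hd := congrArg dim hy
  simp only [map_add, dim_unary, dim_hyp] at hd
  rw [eq_zero_of_dim_eq_zero (x := y) (by omega), add_zero] at hy
  exact hy

theorem rep_add {x y : IsometryClass F} {c : Fˣ} (h : Rep (x + y) c) :
    Rep x c ∨ Rep y c ∨ ∃ u v, Rep x u ∧ Rep y v ∧ (u : F) + v = c := by
  obtain ⟨φ, rfl⟩ := exists_isometryClass_eq x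
  obtain ⟨ψ, rfl⟩ := exists_isometryClass_eq y
  rw [← isometryClass_perp, rep_isometryClass] at h
  obtain ⟨⟨v, w⟩, h⟩ := h
  replace h : φ.form v + ψ.form w = c := h
  simp only [rep_isometryClass]
  by_cases hv : φ.form v = 0
  · exact .inr (.inl ⟨w, by rw [← h, hv, zero_add]⟩)
  by_cases hw : ψ.form w = 0
  · exact .inl ⟨v, by rw [← h, hw, add_zero]⟩
  exact .inr (.inr ⟨Units.mk0 _ hv, Units.mk0 _ hw, ⟨v, rfl⟩, ⟨w, rfl⟩, h⟩)

theorem isotropic_add {x y : IsometryClass F} (h : Isotropic (x + y)) :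
    Isotropic x ∨ Isotropic y ∨ ∃ u, Rep x u ∧ Rep y (-u) := by
  obtain ⟨φ, rfl⟩ := exists_isometryClass_eq x
  obtain ⟨ψ, rfl⟩ := exists_isometryClass_eq y
  rw [← isometryClass_perp, isotropic_isometryClass] at h
  obtain ⟨⟨v, w⟩, hne, h⟩ := h
  replace h : φ.form v + ψ.form w = 0 := h
  simp only [rep_isometryClass, isotropic_isometryClass]
  by_cases hv : φ.form v = 0
  · by_cases hv0 : v = 0
    · exact .inr (.inl ⟨w, fun hw => hne (by rw [hv0, hw]; rfl), by rw [← h, hv, zero_add]⟩)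
    · exact .inl ⟨v, hv0, hv⟩
  · exact .inr (.inr ⟨Units.mk0 _ hv, ⟨v, rfl⟩, w, by
      rw [Units.val_neg, Units.val_mk0]
      linear_combination h⟩)

theorem isotropic_of_rep {x y : IsometryClass F} {u : Fˣ} (hx : Rep x u) (hy : Rep y (-u)) :
    Isotropic (x + y) := by
  obtain ⟨x, rfl⟩ := hx
  obtain ⟨y, rfl⟩ := hy
  exact ⟨x + y, by rw [add_add_add_comm, unary_add_unary_neg]⟩

/-! ### Scaling of isometry classes -/

/-- Scaling of isometry classes, `φ ↦ a φ`. -/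
def sc (a : Fˣ) : IsometryClass F →+ IsometryClass F where
  toFun := Quotient.map (scale a) fun _ _ ⟨g⟩ => ⟨⟨g.toLinearEquiv, fun v =>
    congrArg ((a : F) * ·) (g.map_app v)⟩⟩
  map_zero' := eq_zero_of_dim_eq_zero (Module.finrank_zero_of_subsingleton (M := PUnit.{u + 1}))
  map_add' := by
    rintro ⟨φ⟩ ⟨ψ⟩
    exact Quotient.sound ⟨⟨LinearEquiv.refl F (φ.V × ψ.V), fun v =>
      (mul_add (a : F) (φ.form v.1) (ψ.form v.2)).symm⟩⟩

theorem sc_isometryClass (a : Fˣ) (φ : QForm F) :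
    sc a (isometryClass φ) = isometryClass (scale a φ) := rfl

theorem sc_unary (a u : Fˣ) : sc a (unary u) = unary (a * u) := by
  rw [unary, sc_isometryClass, unary, isometryClass_eq]
  refine ⟨⟨LinearEquiv.refl F (Fin 1 → F), fun v => ?_⟩⟩
  change (diag ![a * u]).form v = a * (diag ![u]).form v
  simp [QuadraticMap.weightedSumSquares_apply, mul_assoc]

theorem sc_sc (a b : Fˣ) (x : IsometryClass F) : sc a (sc b x) = sc (a * b) x := by
  induction x using IsometryClass.induction with
  | zero => simp
  | add u x ih => simp only [map_add, sc_unary, ih, mul_assoc]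

theorem sc_one (x : IsometryClass F) : sc 1 x = x := by
  induction x using IsometryClass.induction with
  | zero => simp
  | add u x ih => simp only [map_add, sc_unary, ih, one_mul]

/-- `⟨a²u⟩ ≅ ⟨u⟩`. -/
theorem unary_mul_sq (u a : Fˣ) : unary (a * a * u) = unary u := by
  obtain ⟨y, hy⟩ : Rep (unary (a * a * u)) u := rep_isometryClass.2 ⟨fun _ => (a⁻¹ : Fˣ), by
    rw [diag_one_apply]
    push_cast
    field_simp⟩
  have hd := congrArg dim hy
  simp only [map_add, dim_unary] at hd
  rwa [eq_zero_of_dim_eq_zero (x := y) (by omega), add_zero] at hy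

theorem sc_mul_self (a : Fˣ) (x : IsometryClass F) : sc (a * a) x = x := by
  induction x using IsometryClass.induction with
  | zero => simp
  | add u x ih => simp only [map_add, sc_unary, ih, unary_mul_sq]

@[simp] theorem dim_sc (a : Fˣ) (x : IsometryClass F) : dim (sc a x) = dim x := by
  induction x using IsometryClass.induction with
  | zero => simp
  | add u x ih => simp only [map_add, sc_unary, ih, dim_unary]

@[simp] theorem sc_hyp (a : Fˣ) : sc a (hyp F) = hyp F := by
  rw [hyp_eq_unary_one, map_add, sc_unary, sc_unary, mul_one, mul_neg_one, unary_add_unary_neg,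
    hyp_eq_unary_one]

theorem Rep.sc {x : IsometryClass F} {u : Fˣ} (h : Rep x u) (a : Fˣ) : Rep (sc a x) (a * u) := by
  obtain ⟨y, rfl⟩ := h
  exact ⟨SupremeTorsion.sc a y, by rw [map_add, sc_unary]⟩

theorem rep_sc {x : IsometryClass F} {a u : Fˣ} : Rep (sc a x) u ↔ Rep x (a⁻¹ * u) := by
  refine ⟨fun h => ?_, fun h => ?_⟩
  · simpa [sc_sc, sc_one] using h.sc a⁻¹
  · simpa using h.sc a

/-- `φ ⊥ -φ` is hyperbolic. -/
theorem add_sc_neg_one (x : IsometryClass F) : x + sc (-1) x = dim x • hyp F := by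
  induction x using IsometryClass.induction with
  | zero => simp
  | add u x ih =>
    rw [map_add, sc_unary, neg_one_mul, add_add_add_comm, ih, unary_add_unary_neg, map_add,
      dim_unary, add_smul, one_smul]

/-! ### The Witt group -/

/-- The Witt class, as a homomorphism on isometry classes. -/
def witt : IsometryClass F →+ WittGroup F :=
  (QuotientAddGroup.mk' (AddSubgroup.zmultiples (grothendieckClass (hyperbolicPlane F)))).comp
    Algebra.GrothendieckAddGroup.of

theorem witt_hyp : witt (hyp F) = 0 :=
  (QuotientAddGroup.eq_zero_iff _).2 (AddSubgroup.mem_zmultiples _)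

/-- A form is zero in the Witt group only if it is hyperbolic. -/
theorem witt_eq_zero_iff {x : IsometryClass F} : witt x = 0 ↔ ∃ m : ℕ, x = m • hyp F := by
  constructor
  · intro h
    obtain ⟨k, hk⟩ := AddSubgroup.mem_zmultiples_iff.1 ((QuotientAddGroup.eq_zero_iff _).1 h)
    replace hk : k • Algebra.GrothendieckAddGroup.of (hyp F) =
      Algebra.GrothendieckAddGroup.of x := hk
    obtain ⟨m, rfl | rfl⟩ := k.eq_nat_or_neg
    · rw [natCast_zsmul, ← map_nsmul] at hk
      exact ⟨m, (Algebra.GrothendieckAddGroup.of_injective hk).symm⟩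
    · rw [neg_smul, natCast_zsmul, ← map_nsmul, eq_comm, eq_neg_iff_add_eq_zero, ← map_add,
        ← map_zero Algebra.GrothendieckAddGroup.of] at hk
      have hd := congrArg dim (Algebra.GrothendieckAddGroup.of_injective hk)
      rw [map_add, map_zero] at hd
      exact ⟨0, by rw [zero_smul]; exact eq_zero_of_dim_eq_zero (by omega)⟩
  · rintro ⟨m, rfl⟩
    rw [map_nsmul, witt_hyp, smul_zero]

theorem isotropic_of_witt_eq_zero {x : IsometryClass F} (h : witt x = 0) (hd : 0 < dim x) :
    Isotropic x := by
  obtain ⟨m, rfl⟩ := witt_eq_zero_iff.1 h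
  obtain _ | m := m
  · simp at hd
  · exact ⟨m • hyp F, by rw [add_smul, one_smul, add_comm]⟩

theorem witt_sc_eq_zero {x : IsometryClass F} (h : witt x = 0) (a : Fˣ) : witt (sc a x) = 0 := by
  obtain ⟨m, rfl⟩ := witt_eq_zero_iff.1 h
  exact witt_eq_zero_iff.2 ⟨m, by rw [map_nsmul, sc_hyp]⟩

theorem witt_sc_neg_one (x : IsometryClass F) : witt (sc (-1) x) = -witt x := by
  rw [eq_neg_iff_add_eq_zero, add_comm, ← map_add, add_sc_neg_one, map_nsmul, witt_hyp, smul_zero]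

theorem witt_surjective : Function.Surjective (witt (F := F)) := by
  intro w
  obtain ⟨g, rfl⟩ := QuotientAddGroup.mk_surjective w
  induction g using AddLocalization.induction_on with
  | H p =>
    obtain ⟨x, y, hy⟩ := p
    refine ⟨x + sc (-1) y, ?_⟩
    rw [map_add, witt_sc_neg_one, ← sub_eq_add_neg]
    change QuotientAddGroup.mk _ - QuotientAddGroup.mk _ = _
    rw [← QuotientAddGroup.mk_sub]
    congr 1
    rw [sub_eq_iff_eq_add]
    rw [AddLocalization.mk_eq_addMonoidOf_mk'_apply]
    exact ((AddLocalization.addMonoidOf ⊤).mk'_spec x ⟨y, hy⟩).symm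

/-- A form is determined up to isometry by its Witt class and its dimension. -/
theorem eq_of_witt_eq_of_dim_eq {x y : IsometryClass F} (hw : witt x = witt y)
    (hd : dim x = dim y) : x = y := by
  have h : witt (x + sc (-1) y) = 0 := by rw [map_add, witt_sc_neg_one, hw, add_neg_cancel]
  obtain ⟨m, hm⟩ := witt_eq_zero_iff.1 h
  have hm' : dim y = m := by
    have := congrArg dim hm
    simp only [map_add, map_nsmul, dim_sc, dim_hyp, smul_eq_mul, hd] at this
    omega
  rw [← hm', ← add_sc_neg_one] at hm
  exact add_right_cancel hm

/-! ### Round forms -/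

/-- A class with the two properties of Pfister forms that are needed: it is round, i.e. every scalar
that it represents is a similarity factor, and it is hyperbolic if it is isotropic. -/
structure PfisterLike (x : IsometryClass F) : Prop where
  round : ∀ u, Rep x u → sc u x = x
  witt_eq_zero : Isotropic x → witt x = 0

/-- `⟨u, v⟩ ⊗ φ ≅ ⟨u + v, uv(u + v)⟩ ⊗ φ`. -/
theorem sc_add_sc {u v w : Fˣ} (h : (u : F) + v = w) (x : IsometryClass F) :
    sc u x + sc v x = sc w x + sc (u * v * w) x := by
  induction x using IsometryClass.induction with
  | zero => simp
  | add t x ih =>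
    have ht : unary (u * t) + unary (v * t) = unary (w * t) + unary (u * v * w * t) := by
      rw [unary_add_unary (u := u * t) (v := v * t) (w := w * t) (by push_cast; rw [← h]; ring),
        ← unary_mul_sq (u * v * w * t) t]
      congr 2
      ac_rfl
    simp only [map_add, sc_unary]
    rw [add_add_add_comm, ih, ht, add_add_add_comm]

theorem Isotropic.of_sc {a : Fˣ} {x : IsometryClass F} (h : Isotropic (sc a x)) : Isotropic x := by
  obtain ⟨y, hy⟩ := h
  refine ⟨sc a⁻¹ y, ?_⟩
  rw [← sc_hyp a⁻¹, ← map_add, ← hy, sc_sc, inv_mul_cancel, sc_one]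

theorem pfisterLike_unary_one : PfisterLike (unary (1 : Fˣ)) where
  round u h := by
    obtain ⟨y, hy⟩ := h
    have hd := congrArg dim hy
    simp only [map_add, dim_unary] at hd
    rw [eq_zero_of_dim_eq_zero (x := y) (by omega), add_zero] at hy
    rw [sc_unary, mul_one, hy]
  witt_eq_zero h := by simpa using h.two_le_dim

/-- The class `φ ⊥ a φ` is that of `⟨1, a⟩ ⊗ φ`. A value `c` is either a value of one summand, or
`c = u + v` with `φ ≅ u φ` and `a φ ≅ v φ`, so that
`φ ⊥ a φ ≅ ⟨u, v⟩ ⊗ φ ≅ ⟨c, uvc⟩ ⊗ φ ≅ c (φ ⊥ a φ)`. -/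
theorem PfisterLike.add_sc {x : IsometryClass F} (hx : PfisterLike x) (a : Fˣ) :
    PfisterLike (x + sc a x) := by
  have hr : ∀ c, Rep (sc a x) c → sc c x = sc a x := fun c hc => by
    conv_rhs => rw [← hx.round _ (rep_sc.1 hc)]
    rw [sc_sc, mul_inv_cancel_left]
  refine ⟨fun c hc => ?_, fun h => ?_⟩
  · rw [map_add, sc_sc, mul_comm c a, ← sc_sc]
    obtain hc | hc | ⟨u, v, hu, hv, huv⟩ := rep_add hc
    · rw [hx.round c hc]
    · rw [hr c hc, sc_sc, sc_mul_self, add_comm]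
    · have hux := hx.round u hu
      have hvx := hr v hv
      have h := sc_add_sc huv x
      rw [hux, hvx, mul_comm u v, mul_comm, ← mul_assoc, ← sc_sc, hux, ← sc_sc, hvx] at h
      rw [h, sc_sc, sc_sc, mul_comm]
  · obtain h | h | ⟨u, hu, hu'⟩ := isotropic_add h
    · rw [map_add, hx.witt_eq_zero h, witt_sc_eq_zero (hx.witt_eq_zero h), add_zero]
    · rw [map_add, hx.witt_eq_zero h.of_sc, witt_sc_eq_zero (hx.witt_eq_zero h.of_sc), add_zero]
    · -- Here `φ ≅ u φ` and `a φ ≅ -u φ`.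
      rw [← hr _ hu', ← mul_neg_one, mul_comm, ← sc_sc, hx.round u hu, add_sc_neg_one, map_nsmul,
        witt_hyp, smul_zero]

theorem PfisterLike.two_pow_smul {x : IsometryClass F} (hx : PfisterLike x) (k : ℕ) :
    PfisterLike (2 ^ k • x) := by
  induction k with
  | zero => simpa using hx
  | succ k ih =>
    have := ih.add_sc 1
    rwa [sc_one, ← two_nsmul, ← mul_nsmul', ← pow_succ'] at this

theorem pfisterLike_two_pow_smul (k : ℕ) (s : Fˣ) :
    PfisterLike (2 ^ k • (unary 1 + unary (-s))) := by
  have := pfisterLike_unary_one.add_sc (-s)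
  rw [sc_unary, mul_one] at this
  exact this.two_pow_smul k

end

/-! ### Sums of squares -/

theorem eq_zero_of_mul_self_add_isSumSq {F : Type*} [Field F] [IsSemireal F] {a s : F}
    (hs : IsSumSq s) (h : a * a + s = 0) :
    a = 0 := by
  by_contra ha
  refine IsSemireal.one_add_ne_zero (hs.mul (IsSumSq.mul_self a⁻¹)) ?_
  field_simp
  linear_combination h

section

variable {F : Type u} [Field F] [NeZero (2 : F)]

theorem isometryClass_copies (m : ℕ) (φ : QForm F) :
    isometryClass (copies m φ) = m • isometryClass φ := by
  induction m with
  | zero => exact (zero_nsmul _).symm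
  | succ m ih => rw [succ_nsmul, ← ih]; rfl

theorem exists_rep_of_isSumSq {s : Fˣ} (hs : IsSumSq (s : F)) :
    ∃ k : ℕ, Rep (2 ^ k • unary 1) s := by
  have key : ∀ t : F, IsSumSq t → ∃ (N : ℕ) (φ : QForm F) (v : φ.V),
      isometryClass φ = N • unary 1 ∧ φ.form v = t := by
    intro t ht
    induction ht with
    | zero => exact ⟨0, zero F, 0, (zero_nsmul _).symm, rfl⟩
    | sq_add a _ ih =>
      obtain ⟨N, φ, v, hφ, hv⟩ := ih
      refine ⟨N + 1, perp (diag ![1]) φ, (fun _ => a, v), ?_, ?_⟩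
      · rw [succ_nsmul', ← hφ]
        rfl
      · rw [← hv]
        simp [QuadraticMap.weightedSumSquares_apply]
  obtain ⟨N, φ, v, hφ, hv⟩ := key s hs
  -- `N ≤ 2 ^ N`, so `N × ⟨1⟩` is a subform of `2 ^ N × ⟨1⟩`.
  refine ⟨N, ?_⟩
  obtain ⟨m, hm⟩ := Nat.exists_eq_add_of_le (Nat.lt_two_pow_self (n := N)).le
  rw [hm, add_nsmul, ← hφ]
  exact (rep_isometryClass.2 ⟨v, hv⟩).add_right _

theorem isSumSq_of_rep {N : ℕ} {u : Fˣ} (h : Rep (N • unary 1) u) : IsSumSq (u : F) := by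
  induction N generalizing u with
  | zero =>
    obtain ⟨y, hy⟩ := h
    have := congrArg dim hy
    simp only [map_add, dim_unary, zero_smul, map_zero] at this
    omega
  | succ N ih =>
    have h1 : ∀ w : Fˣ, Rep (unary 1) w → IsSumSq (w : F) := fun w hw => by
      obtain ⟨v, hv⟩ := rep_isometryClass.1 hw
      rw [← hv, diag_one_apply, Units.val_one, one_mul]
      exact .mul_self _
    rw [succ_nsmul] at h
    obtain h | h | ⟨v, w, hv, hw, hvw⟩ := rep_add h
    · exact ih h
    · exact h1 u h
    · exact hvw ▸ (ih hv).add (h1 w hw)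

/-- Since `2 ^ k × ⟨1⟩` is round, it is isometric to `s (2 ^ k × ⟨1⟩)` as soon as it
represents `s`. -/
theorem exists_two_pow_smul_witt_eq_zero {s : Fˣ} (hs : IsSumSq (s : F)) :
    ∃ k : ℕ, 2 ^ k • witt (unary 1 + unary (-s)) = 0 := by
  obtain ⟨k, hk⟩ := exists_rep_of_isSumSq hs
  refine ⟨k, ?_⟩
  have h := (pfisterLike_unary_one.two_pow_smul k).round s hk
  rw [map_nsmul, sc_unary, mul_one] at h
  rw [← map_nsmul, nsmul_add, ← h, ← nsmul_add, unary_add_unary_neg, map_nsmul, witt_hyp, smul_zero]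

/-- `⟨a⟩` and `⟨as⟩` differ by `a⟨1, -s⟩` in the Witt group. -/
theorem smul_witt_unary_mul {K : ℕ} {s : Fˣ} (hs : K • witt (unary 1 + unary (-s)) = 0) (a : Fˣ) :
    K • witt (unary (a * s)) = K • witt (unary a) := by
  rw [← map_nsmul] at hs
  have h := witt_sc_eq_zero hs a
  have h' : sc (-1) (unary (a * s)) = unary (a * -s) := by rw [sc_unary, neg_one_mul, mul_neg]
  rw [map_nsmul, map_add, sc_unary, sc_unary, mul_one, ← h', map_nsmul, map_add, witt_sc_neg_one,
    ← sub_eq_add_neg, smul_sub, sub_eq_zero] at h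
  exact h.symm

section Semireal

variable [IsSemireal F]

/-- The values of `N × ⟨a⟩` are `a s` with `s` a sum of squares; since the field is formally real,
`s = 0` only at the zero vector. -/
theorem exists_isSumSq_of_copies (N : ℕ) (a : Fˣ) (v : (copies N (diag ![a])).V) :
    ∃ s : F, IsSumSq s ∧ (copies N (diag ![a])).form v = a * s ∧ (s = 0 → v = 0) := by
  induction N with
  | zero => exact ⟨0, .zero, (mul_zero _).symm, fun _ => rfl⟩
  | succ N ih =>
    obtain ⟨v, w⟩ := v
    obtain ⟨s, hs, hv, h0⟩ := ih v
    refine ⟨w 0 * w 0 + s, .sq_add _ hs, ?_, fun h => ?_⟩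
    · change (copies N (diag ![a])).form v + (diag ![a]).form w = _
      rw [hv, diag_one_apply]
      ring
    · have hw := eq_zero_of_mul_self_add_isSumSq hs h
      rw [hw, mul_zero, zero_add] at h
      refine Prod.ext (h0 h) (funext fun i => ?_)
      rw [Subsingleton.elim i 0]
      exact hw

/-- Write `x = ⟨a₁, …, a_d⟩`. A value of `N × x` has the form `∑ aᵢ sᵢ` with sums of squares `sᵢ`,
hence is a value of the form obtained from `x` by replacing `aᵢ` by `aᵢ sᵢ` whenever `sᵢ ≠ 0`. If
`K` annihilates all `⟨1, -s⟩` with `s` a sum of squares, this changes the Witt class only by an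
element annihilated by `K`. -/
theorem exists_apply_eq_of_smul {K : ℕ}
    (hK : ∀ s : Fˣ, IsSumSq (s : F) → K • witt (unary 1 + unary (-s)) = 0) (N : ℕ)
    (x : IsometryClass F) (φ : QForm F) (hφ : isometryClass φ = N • x) (v : φ.V) :
    ∃ (ψ : QForm F) (w : ψ.V), dim (isometryClass ψ) = dim x ∧
      K • witt (isometryClass ψ) = K • witt x ∧ ψ.form w = φ.form v ∧ (w = 0 → v = 0) := by
  induction x using IsometryClass.induction generalizing φ with
  | zero =>
    rw [smul_zero] at hφ
    have hd : Module.finrank F φ.V = 0 := by rw [← dim_isometryClass, hφ, map_zero]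
    have : Subsingleton φ.V := Module.finrank_zero_iff.1 hd
    refine ⟨zero F, 0, rfl, rfl, ?_, fun _ => Subsingleton.elim _ _⟩
    rw [Subsingleton.elim v 0, QuadraticMap.map_zero, QuadraticMap.map_zero]
  | add a x ih =>
    obtain ⟨φ', hφ'⟩ := exists_isometryClass_eq (N • x)
    rw [smul_add, unary, ← isometryClass_copies, ← hφ', ← isometryClass_perp] at hφ
    obtain ⟨g⟩ := isometryClass_eq.1 hφ
    rw [← g.map_app]
    have hg0 : g v = 0 → v = 0 := fun h => g.injective (h.trans (map_zero g).symm)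
    generalize g v = v' at hg0 ⊢
    obtain ⟨v₁, v₂⟩ := v'
    obtain ⟨ψ, w, hd, hw, hval, h0⟩ := ih φ' hφ' v₂
    obtain ⟨s, hs, hs', hs0⟩ := exists_isSumSq_of_copies N a v₁
    have hform : (perp (copies N (diag ![a])) φ').form (v₁, v₂) = a * s + ψ.form w := by
      rw [← hs', hval]
      rfl
    rw [hform]
    by_cases hsz : s = 0
    · refine ⟨perp (diag ![a]) ψ, (0, w), ?_, ?_, ?_, fun h => hg0 ?_⟩
      · rw [isometryClass_perp, map_add, map_add, hd]
        rfl
      · rw [isometryClass_perp, map_add, map_add, smul_add, smul_add, hw]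
        rfl
      · rw [hsz]
        change (diag ![a]).form 0 + ψ.form w = _
        rw [QuadraticMap.map_zero, mul_zero]
      · exact Prod.ext (hs0 hsz) (h0 (congrArg Prod.snd h))
    · refine ⟨perp (diag ![a * Units.mk0 s hsz]) ψ, (fun _ => 1, w), ?_, ?_, ?_, fun h => ?_⟩
      · rw [isometryClass_perp, map_add, map_add, hd]
        change dim (unary _) + _ = _
        rw [dim_unary, dim_unary]
      · rw [isometryClass_perp, map_add, map_add, smul_add, smul_add, hw]
        congr 1
        exact smul_witt_unary_mul (hK _ hs) a
      · change (diag ![a * Units.mk0 s hsz]).form (fun _ => 1) + ψ.form w = _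
        rw [diag_one_apply]
        simp
      · exact absurd (congrFun (congrArg Prod.fst h) 0) one_ne_zero

/-- If `K` annihilates `⟨1, -s⟩` for all sums of squares `s`, then it annihilates all torsion. The
proof is by induction on the dimension: a multiple of a torsion form is isotropic, so up to elements
annihilated by `K` a hyperbolic plane can be split off. -/
theorem smul_witt_eq_zero_of_torsion {K : ℕ} (hK0 : 0 < K)
    (hK : ∀ s : Fˣ, IsSumSq (s : F) → K • witt (unary 1 + unary (-s)) = 0)
    (x : IsometryClass F) {N : ℕ} (hN : 0 < N) (hx : N • witt x = 0) : K • witt x = 0 := by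
  induction h : dim x using Nat.strong_induction_on generalizing x N with
  | _ d ih =>
    obtain rfl | hd := Nat.eq_zero_or_pos d
    · rw [eq_zero_of_dim_eq_zero h, map_zero, smul_zero]
    · have hiso : Isotropic (N • x) := by
        refine isotropic_of_witt_eq_zero (by rw [map_nsmul, hx]) ?_
        rw [map_nsmul, smul_eq_mul, h]
        exact Nat.mul_pos hN hd
      obtain ⟨φ, hφ⟩ := exists_isometryClass_eq (N • x)
      rw [← hφ] at hiso
      obtain ⟨v, hv, hv0⟩ := isotropic_isometryClass.1 hiso
      obtain ⟨ψ, w, hψ, hKψ, hw, h0⟩ := exists_apply_eq_of_smul hK N x φ hφ v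
      obtain ⟨z, hz⟩ : Isotropic (isometryClass ψ) :=
        isotropic_isometryClass.2 ⟨w, fun h => hv (h0 h), hw.trans hv0⟩
      rw [hz, map_add, dim_hyp] at hψ
      rw [hz, map_add, witt_hyp, zero_add] at hKψ
      rw [← hKψ]
      refine ih (dim z) (by omega) z (N := N * K) (Nat.mul_pos hN hK0) ?_ rfl
      rw [mul_nsmul', hKψ, ← mul_nsmul', mul_comm, mul_nsmul', hx, smul_zero]

end Semireal

end

/-! ### The height and supreme Pfister forms -/

section

variable {F : Type u} [Field F] [NeZero (2 : F)]

theorem witt_mem_torsion {x : IsometryClass F} :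
    witt x ∈ AddCommGroup.torsion (WittGroup F) ↔ ∃ N : ℕ, 0 < N ∧ N • witt x = 0 :=
  isOfFinAddOrder_iff_nsmul_eq_zero

theorem exponent_torsion_dvd_iff {K : ℕ} :
    AddMonoid.exponent (AddCommGroup.torsion (WittGroup F)) ∣ K ↔
      ∀ x : IsometryClass F, ∀ N : ℕ, 0 < N → N • witt x = 0 → K • witt x = 0 := by
  rw [AddMonoid.exponent_dvd_iff_forall_nsmul_eq_zero]
  constructor
  · intro h x N hN hx
    have := congrArg Subtype.val (h ⟨witt x, witt_mem_torsion.2 ⟨N, hN, hx⟩⟩)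
    simpa using this
  · rintro h ⟨w, hw⟩
    obtain ⟨x, rfl⟩ := witt_surjective w
    obtain ⟨N, hN, hx⟩ := witt_mem_torsion.1 hw
    exact Subtype.ext (h x N hN hx)

theorem finrank_pfister {n : ℕ} (a : Fin n → Fˣ) :
    Module.finrank F (pfister a).V = 2 ^ n := by
  induction n with
  | zero => exact Module.finrank_fin_fun F
  | succ n ih =>
    change Module.finrank F (TensorProduct F (Fin 2 → F) (pfister (Fin.tail a)).V) = _
    rw [Module.finrank_tensorProduct, ih, Module.finrank_fin_fun, pow_succ']

theorem exists_pfister_apply_eq_one {n : ℕ} (a : Fin n → Fˣ) :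
    ∃ v, (pfister a).form v = 1 := by
  induction n with
  | zero =>
    refine ⟨fun _ => 1, ?_⟩
    change (diag ![1]).form _ = _
    rw [diag_one_apply]
    simp
  | succ n ih =>
    obtain ⟨v, hv⟩ := ih (Fin.tail a)
    let : Invertible (2 : F) := invertibleOfNonzero (NeZero.ne 2)
    refine ⟨TensorProduct.tmul F (![1, 0] : Fin 2 → F) v, ?_⟩
    refine (QuadraticForm.tensorDistrib_tmul (diag ![1, -a 0]).form
      (pfister (Fin.tail a)).form ![1, 0] v).trans ?_
    rw [hv]
    simp [QuadraticMap.weightedSumSquares_apply]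

/-- Being a supreme torsion form, in terms of isometry classes. -/
theorem IsSupremeTorsionForm.exists_eq_sc_add {π : QForm F} (h : IsSupremeTorsionForm π)
    {x : IsometryClass F} (hx : ¬ Isotropic x) {N : ℕ} (hN : 0 < N) (ht : N • witt x = 0) :
    ∃ a y, isometryClass π = sc a x + y := by
  obtain ⟨φ, rfl⟩ := exists_isometryClass_eq x
  obtain ⟨χ, ⟨τ, hτ⟩, a, ha⟩ := h.2.2 φ
    (by rwa [isotropic_isometryClass_iff, not_not] at hx) (witt_mem_torsion.2 ⟨N, hN, ht⟩)
  exact ⟨a, isometryClass τ, by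
    rw [sc_isometryClass, isometryClass_eq.2 ha, ← isometryClass_perp, isometryClass_eq.2 hτ]⟩

theorem isSubform_iff {φ ψ : QForm F} :
    IsSubform φ ψ ↔ ∃ y, isometryClass ψ = isometryClass φ + y := by
  constructor
  · rintro ⟨τ, hτ⟩
    exact ⟨isometryClass τ, (isometryClass_eq.2 hτ).symm⟩
  · rintro ⟨y, hy⟩
    obtain ⟨τ, rfl⟩ := exists_isometryClass_eq y
    exact ⟨τ, isometryClass_eq.1 hy.symm⟩

theorem dim_eq_of_isPfister {n : ℕ} {π : QForm F} (h : IsPfister n π) :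
    dim (isometryClass π) = 2 ^ n := by
  obtain ⟨a, ha⟩ := h
  rw [isometryClass_eq.2 ha, dim_isometryClass, finrank_pfister]

theorem rep_one_of_isPfister {n : ℕ} {π : QForm F} (h : IsPfister n π) :
    Rep (isometryClass π) 1 := by
  obtain ⟨a, ha⟩ := h
  rw [isometryClass_eq.2 ha, rep_isometryClass]
  exact exists_pfister_apply_eq_one a

theorem exists_pos_smul_two_pow_smul_witt_eq_zero {s : Fˣ} (hs : IsSumSq (s : F)) (k : ℕ) :
    ∃ N : ℕ, 0 < N ∧ N • witt (2 ^ k • (unary 1 + unary (-s))) = 0 := by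
  obtain ⟨m, hm⟩ := exists_two_pow_smul_witt_eq_zero hs
  exact ⟨2 ^ m, by positivity, by rw [map_nsmul, smul_comm, hm, smul_zero]⟩

theorem dim_two_pow_smul (k : ℕ) (s : Fˣ) :
    dim (2 ^ k • (unary 1 + unary (-s))) = 2 ^ (k + 1) := by
  simp [pow_succ, mul_two]

/-- The Pfister form `2 ^ n × ⟨1, -s⟩` is torsion and too large to be a subform of a multiple of
`π`, so it is isotropic and therefore hyperbolic. -/
theorem IsSupremeTorsionForm.two_pow_smul_witt_eq_zero {π : QForm F} {n : ℕ}
    (h : IsSupremeTorsionForm π) (hd : dim (isometryClass π) = 2 ^ n) {s : Fˣ}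
    (hs : IsSumSq (s : F)) : 2 ^ n • witt (unary 1 + unary (-s)) = 0 := by
  obtain ⟨N, hN, ht⟩ := exists_pos_smul_two_pow_smul_witt_eq_zero hs n
  rw [← map_nsmul]
  refine (pfisterLike_two_pow_smul n s).witt_eq_zero ?_
  by_contra hiso
  obtain ⟨a, y, hy⟩ := h.exists_eq_sc_add hiso hN ht
  have := congrArg dim hy
  rw [hd, map_add, dim_sc, dim_two_pow_smul, pow_succ] at this
  have := Nat.two_pow_pos n
  omega

/-- The Pfister form `2 ^ (n - 1) × ⟨1, -s⟩` is anisotropic and of the dimension of `π`, hence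
similar to `π`; since `π` represents `1` and Pfister forms are round, it is isometric to `π`. -/
theorem IsSupremeTorsionForm.eq_two_pow_smul {π : QForm F} {n : ℕ}
    (h : IsSupremeTorsionForm π) (hd : dim (isometryClass π) = 2 ^ (n + 1))
    (h1 : Rep (isometryClass π) 1) {s : Fˣ} (hs : IsSumSq (s : F))
    (hne : 2 ^ n • witt (unary 1 + unary (-s)) ≠ 0) :
    isometryClass π = 2 ^ n • (unary 1 + unary (-s)) := by
  obtain ⟨N, hN, ht⟩ := exists_pos_smul_two_pow_smul_witt_eq_zero hs n
  have hP := pfisterLike_two_pow_smul n s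
  rw [← map_nsmul] at hne
  obtain ⟨b, y, hy⟩ := h.exists_eq_sc_add (fun hi => hne (hP.witt_eq_zero hi)) hN ht
  have hd' := congrArg dim hy
  rw [hd, map_add, dim_sc, dim_two_pow_smul] at hd'
  rw [eq_zero_of_dim_eq_zero (x := y) (by omega), add_zero] at hy
  rw [hy] at h1
  have hb := hP.round _ (rep_sc.1 h1)
  rw [hy]
  conv_lhs => rw [← hb]
  rw [sc_sc, mul_one, mul_inv_cancel, sc_one]

/-- If `2 ^ k` annihilates the Witt class of `⟨1, -s⟩`, then `s` is a sum of `2 ^ k` squares. -/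
theorem rep_two_pow_smul_unary_one {k : ℕ} {s : Fˣ}
    (h : 2 ^ k • witt (unary 1 + unary (-s)) = 0) : Rep (2 ^ k • unary 1) s := by
  have h' := smul_witt_unary_mul h 1
  rw [one_mul, ← map_nsmul, ← map_nsmul] at h'
  rw [← eq_of_witt_eq_of_dim_eq h' (by simp)]
  obtain ⟨m, hm⟩ := Nat.exists_eq_succ_of_ne_zero (Nat.two_pow_pos k).ne'
  exact ⟨m • unary s, by rw [hm, succ_nsmul']⟩

/-- If `2 ^ k × ⟨1⟩ ⊥ τ` is torsion, then the values of `τ` are negatives of sums of squares. If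
`2 ^ k` annihilated all torsion, these would be negatives of values of `2 ^ k × ⟨1⟩`, and the form
would be isotropic. -/
theorem isotropic_of_two_pow_smul_add {k : ℕ}
    (hk : ∀ s : Fˣ, IsSumSq (s : F) → 2 ^ k • witt (unary 1 + unary (-s)) = 0)
    {y : IsometryClass F} (hy : dim y = 2 ^ k) {N : ℕ} (hN : 0 < N)
    (ht : N • witt (2 ^ k • unary 1 + y) = 0) : Isotropic (2 ^ k • unary 1 + y) := by
  obtain ⟨d, hd⟩ := exists_rep_of_dim_pos (x := y) (by rw [hy]; positivity)
  have heq : N • y = sc (-1) (N • 2 ^ k • unary 1) := by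
    refine eq_of_witt_eq_of_dim_eq ?_ (by simp [hy])
    rw [witt_sc_neg_one, eq_neg_iff_add_eq_zero, ← map_add, add_comm, ← nsmul_add, map_nsmul, ht]
  have hNd : Rep (N • y) d := by
    obtain ⟨m, rfl⟩ := Nat.exists_eq_succ_of_ne_zero hN.ne'
    rw [succ_nsmul]
    exact hd.add_left _
  rw [heq, rep_sc, ← mul_nsmul'] at hNd
  have hs := isSumSq_of_rep hNd
  have hrep := rep_two_pow_smul_unary_one (hk _ hs)
  refine isotropic_of_rep hrep ?_
  simpa using hd

end

end SupremeTorsion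

open SupremeTorsion in
theorem mainTheorem4 {F : Type*} [Field F] [IsSemireal F]
    (hF : ∃ x : F, IsSumSq x ∧ ¬ IsSquare x)
    (n : ℕ) (hn : 1 ≤ n) (π : SupremeTorsion.QForm F)
    (hπ : SupremeTorsion.QForm.IsPfister n π)
    (hsup : SupremeTorsion.IsSupremeTorsionForm π) :
    SupremeTorsion.height F ≤ ((2 ^ n : ℕ) : ℕ∞) ∧
      (SupremeTorsion.height F = ((2 ^ n : ℕ) : ℕ∞) ↔
        SupremeTorsion.QForm.IsSubform
          (SupremeTorsion.QForm.copies (2 ^ (n - 1)) (SupremeTorsion.QForm.diag ![1])) π) := by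
  obtain ⟨n, rfl⟩ := Nat.exists_eq_add_of_le' hn
  have hdim := dim_eq_of_isPfister hπ
  -- The exponent divides `2 ^ k` as soon as `2 ^ k` annihilates the forms `⟨1, -s⟩`.
  have hdvd : ∀ k, (∀ s : Fˣ, IsSumSq (s : F) → 2 ^ k • witt (unary 1 + unary (-s)) = 0) →
      AddMonoid.exponent (AddCommGroup.torsion (WittGroup F)) ∣ 2 ^ k := fun k hk =>
    exponent_torsion_dvd_iff.2 fun x _ hN hx =>
      smul_witt_eq_zero_of_torsion (Nat.two_pow_pos k) hk x hN hx
  have hE := hdvd (n + 1) fun s hs => hsup.two_pow_smul_witt_eq_zero hdim hs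
  -- So the exponent is not `0`, and the height is not `⊤`.
  have hE0 : AddMonoid.exponent (AddCommGroup.torsion (WittGroup F)) ≠ 0 :=
    (Nat.pos_of_dvd_of_pos hE (Nat.two_pow_pos _)).ne'
  have hh : height F = (AddMonoid.exponent (AddCommGroup.torsion (WittGroup F)) : ℕ∞) :=
    if_neg hE0
  rw [hh, Nat.cast_le, Nat.cast_inj, isSubform_iff, isometryClass_copies, Nat.add_sub_cancel]
  refine ⟨Nat.le_of_dvd (Nat.two_pow_pos _) hE, fun h => ?_, ?_⟩
  · obtain ⟨s, hs, hne⟩ : ∃ s : Fˣ, IsSumSq (s : F) ∧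
        2 ^ n • witt (unary 1 + unary (-s)) ≠ 0 := by
      by_contra! H
      have := Nat.le_of_dvd (Nat.two_pow_pos n) (hdvd n H)
      rw [h, pow_succ] at this
      have := Nat.two_pow_pos n
      omega
    refine ⟨2 ^ n • unary (-s), ?_⟩
    rw [hsup.eq_two_pow_smul hdim (rep_one_of_isPfister hπ) hs hne, nsmul_add]
    rfl
  · rintro ⟨y, hy⟩
    change isometryClass π = 2 ^ n • unary 1 + y at hy
    by_contra hne
    obtain ⟨j, hj, hEj⟩ := (Nat.dvd_prime_pow Nat.prime_two).1 hE
    have hEn : AddMonoid.exponent (AddCommGroup.torsion (WittGroup F)) ∣ 2 ^ n := by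
      rw [hEj] at hne ⊢
      refine pow_dvd_pow 2 (Nat.le_of_lt_succ (lt_of_le_of_ne hj ?_))
      rintro rfl
      exact hne rfl
    obtain ⟨N, hN, ht⟩ := witt_mem_torsion.1 hsup.2.1
    have hdy := congrArg dim hy
    rw [hdim, map_add, map_nsmul, dim_unary, smul_eq_mul, mul_one, pow_succ] at hdy
    rw [hy] at ht
    refine isotropic_isometryClass_iff.1 (hy ▸ isotropic_of_two_pow_smul_add (fun s hs => ?_)
      (by omega) hN ht) hsup.1
    obtain ⟨M, hM, hMs⟩ := exists_pos_smul_two_pow_smul_witt_eq_zero hs 0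
    rw [pow_zero, one_smul] at hMs
    exact exponent_torsion_dvd_iff.1 hEn _ M hM hMs
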